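/- Let $K$ be a field, let $d>0$ be an integer, and let $S=K[x_1,\ldots,x_{3d}]$. Let $I\subset S$ be the ideal generated by the polynomials $$x_{3i-2}^2-x_{3i-1}x_{3i},\qquad x_{3i-2}x_{3i-1}-x_{3i}^2,\qquad x_{3i-2}x_{3i}-x_{3i-1}^2\qquad(1\le i\le d).$$ Then $I$ is a homogeneous ideal, and $S/I$ is a Cohen–Macaulay ring of Krull dimension $d$. For $0\le r\le d$ let $\mathbf w_r=(1,2,2,\ldots,1,2,2,\,1,1,1,\ldots,1,1,1)\in\mathbb Z^{3d}$, with $r$ blocks $(1,2,2)$ followed by $d-r$ blocks $(1,1,1)$, and let $<_r$ be the monomial order on $S$ with $u<_r v$ if and only if either the weight of $u$ with respect to $\mathbf w_r$ is less than that of $v$, or the two weights are equal and $u\prec v$, where $\prec$ is the lexicographic order with $x_{3d}\prec\cdots\prec x_2\prec x_1$. (The weight of $x_1^{a_1}\cdots x_{3d}^{a_{3d}}$ with respect to $\mathbf w$ is $\sum_k a_kw_k$.) Then, for every $0\le r\le d$: - the set $A\cup B$ is a Gröbner basis of $I$ with respect to $<_r$, where $$A=\{x_{3i-1}x_{3i}-x_{3i-2}^2,\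 x_{3i-1}^2-x_{3i-2}x_{3i},\ x_{3i}^2-x_{3i-2}x_{3i-1} : 1\le i\le r\},$$ $$B=\{x_{3i-2}^2-x_{3i-1}x_{3i},\ x_{3i-2}x_{3i-1}-x_{3i}^2,\ x_{3i-2}x_{3i}-x_{3i-1}^2,\ x_{3i-1}^3-x_{3i}^3 : r+1\le i\le d\};$$ - $\operatorname{depth}\bigl(S/\mathrm{in}_{<_r}(I)\bigr)=r$, where $\mathrm{in}_{<_r}(I)$ is the initial ideal of $I$ with respect to $<_r$, and the depth is taken with respect to the graded maximal ideal $(x_1,\ldots,x_{3d})$. In particular, for each integer $d>0$ there is a homogeneous ideal $I$ of $S$ such that $S/I$ is Cohen–Macaulay of dimension $d$ and, for each $0\le r\le d$, there is a monomial order $<_r$ on $S$ with $\operatorname{depth}(S/\mathrm{in}_{<_r}(I))=r$. -/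

import Mathlib

/-! ### Depth and Cohen–Macaulay rings -/

open Classical in
/-- The `J`-depth of an `R`-module `M` (in practice `R` Noetherian, `M` finitely generated):
the supremum of the lengths of the `M`-regular sequences with entries in the ideal `J`,
and `∞` if `J M = M`. -/
noncomputable def Ideal.depthOn {R : Type*} [CommRing R] (J : Ideal R)
    (M : Type*) [AddCommGroup M] [Module R M] : ℕ∞ :=
  if J • (⊤ : Submodule R M) = ⊤ then ⊤
  else sSup {n : ℕ∞ | ∃ rs : List R, (∀ a ∈ rs, a ∈ J) ∧
    RingTheory.Sequence.IsRegular M rs ∧ n = (rs.length : ℕ∞)}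

/-- A ring is Cohen–Macaulay if it is Noetherian and each of its localizations at a maximal
ideal is a Cohen–Macaulay local ring, that is, has depth equal to its Krull dimension. -/
def IsCohenMacaulayRing (R : Type*) [CommRing R] : Prop :=
  IsNoetherianRing R ∧ ∀ (P : Ideal R) [P.IsMaximal],
    (((IsLocalRing.maximalIdeal (Localization.AtPrime P)).depthOn
      (Localization.AtPrime P) : ℕ∞) : WithBot ℕ∞) = ringKrullDim (Localization.AtPrime P)

/-- The depth of `S / J` for an ideal `J` of the polynomial ring `S` over `K`: its depth with
respect to the graded maximal ideal, generated by all the variables. -/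
noncomputable def MvPolynomial.depthQuotient {σ K : Type*} [Field K]
    (J : Ideal (MvPolynomial σ K)) : ℕ∞ :=
  (MvPolynomial.idealOfVars σ K).depthOn (MvPolynomial σ K ⧸ J)

/-! ### Initial ideals and Gröbner bases -/

namespace MonomialOrder

variable {σ K : Type*} [Field K]

/-- The initial ideal of `I`: generated by the leading monomials of the nonzero elements of `I`. -/
noncomputable def initialIdeal (m : MonomialOrder σ) (I : Ideal (MvPolynomial σ K)) :
    Ideal (MvPolynomial σ K) :=
  Ideal.span {u | ∃ f ∈ I, f ≠ 0 ∧ u = MvPolynomial.monomial (m.degree f) (1 : K)}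

/-- `G` is a Gröbner basis of `I`: a finite set of nonzero elements of `I` whose leading
monomials generate the initial ideal of `I`. -/
def IsGroebnerBasis (m : MonomialOrder σ) (G : Set (MvPolynomial σ K))
    (I : Ideal (MvPolynomial σ K)) : Prop :=
  G.Finite ∧ (∀ g ∈ G, g ≠ 0) ∧ G ⊆ I ∧
    Ideal.span {u | ∃ g ∈ G, u = MvPolynomial.monomial (m.degree g) (1 : K)} = m.initialIdeal I

end MonomialOrder

/-! ### Weighted lexicographic orders -/

/-- Type synonym of `σ →₀ ℕ`, ordered by the weight for `w`, ties broken lexicographically. -/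
def WeightedLex {σ : Type*} (_w : σ → ℕ) : Type _ := σ →₀ ℕ

namespace WeightedLex

variable {σ : Type*} (w : σ → ℕ)

noncomputable instance : AddCommMonoid (WeightedLex w) :=
  inferInstanceAs (AddCommMonoid (σ →₀ ℕ))

/-- The identity map from exponents to the type synonym. -/
noncomputable def equiv : (σ →₀ ℕ) ≃+ WeightedLex w := AddEquiv.refl (σ →₀ ℕ)

/-- The pair (weight, exponent) of an element. -/
noncomputable def key (a : WeightedLex w) : ℕ ×ₗ Lex (σ →₀ ℕ) :=
  toLex (Finsupp.weight w ((equiv w).symm a), toLex ((equiv w).symm a))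

theorem key_injective : Function.Injective (key w) := fun a b h => by
  have h2 := congrArg (fun p => ofLex (ofLex p).2) h
  exact (equiv w).symm.injective h2

variable [LinearOrder σ]

noncomputable instance : LinearOrder (WeightedLex w) :=
  LinearOrder.lift' (key w) (key_injective w)

theorem le_iff_key {a b : WeightedLex w} : a ≤ b ↔ key w a ≤ key w b := Iff.rfl

theorem lt_iff_key {a b : WeightedLex w} : a < b ↔ key w a < key w b := Iff.rfl

instance : IsOrderedAddMonoid (WeightedLex w) where
  add_le_add_left a b h c := by
    rw [le_iff_key] at h ⊢
    simp only [key, map_add, toLex_add, Prod.Lex.toLex_le_toLex] at h ⊢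
    simpa using h

instance [WellFoundedGT σ] : WellFoundedLT (WeightedLex w) :=
  ⟨InvImage.wf (key w) (wellFounded_lt (α := ℕ ×ₗ Lex (σ →₀ ℕ)))⟩

end WeightedLex

namespace MonomialOrder

variable {σ : Type*} [LinearOrder σ] [WellFoundedGT σ]

/-- The weighted lexicographic order: compare the weights for `w` first, and break ties by the
lexicographic order (in which a variable with a smaller index is larger). -/
noncomputable def weightedLex (w : σ → ℕ) : MonomialOrder σ where
  syn := WeightedLex w
  toSyn := WeightedLex.equiv w
  toSyn_monotone a b h := by
    rw [WeightedLex.le_iff_key]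
    simp only [WeightedLex.key, AddEquiv.symm_apply_apply, Prod.Lex.toLex_le_toLex]
    have hw : Finsupp.weight w a ≤ Finsupp.weight w b := by
      rw [← add_tsub_cancel_of_le h, map_add]
      exact Nat.le_add_right _ _
    rcases hw.lt_or_eq with h1 | h1
    · exact Or.inl h1
    · exact Or.inr ⟨h1, Finsupp.toLex_monotone h⟩

open scoped MonomialOrder in
theorem weightedLex_lt_iff (w : σ → ℕ) (a b : σ →₀ ℕ) :
    a ≺[weightedLex w] b ↔ Finsupp.weight w a < Finsupp.weight w b ∨
      (Finsupp.weight w a = Finsupp.weight w b ∧ toLex a < toLex b) := by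
  change WeightedLex.equiv w a < WeightedLex.equiv w b ↔ _
  rw [WeightedLex.lt_iff_key]
  simp only [WeightedLex.key, AddEquiv.symm_apply_apply, Prod.Lex.toLex_lt_toLex]

end MonomialOrder

/-! ### The ideal, the orders and the Gröbner bases

The variables are `X 0, …, X (3 * d - 1)`. They are split into `d` blocks, numbered from `0`:
block `i` consists of `X (3 * i)`, `X (3 * i + 1)`, `X (3 * i + 2)`. -/

namespace TripleIdeal

open MvPolynomial

variable (K : Type*) [Field K]

/-- The variable number `j` of the block number `i`. -/
noncomputable def x {d : ℕ} (i : Fin d) (j : Fin 3) : MvPolynomial (Fin (3 * d)) K :=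
  X ⟨3 * (i : ℕ) + (j : ℕ), by omega⟩

/-- The ideal `I`, with three quadratic generators for each block. -/
noncomputable def ideal (d : ℕ) : Ideal (MvPolynomial (Fin (3 * d)) K) :=
  Ideal.span (⋃ i : Fin d,
    {x K i 0 ^ 2 - x K i 1 * x K i 2,
     x K i 0 * x K i 1 - x K i 2 ^ 2,
     x K i 0 * x K i 2 - x K i 1 ^ 2})

/-- The weight vector: `(1, 2, 2)` on each of the first `r` blocks and `(1, 1, 1)` on the
others. -/
def weight (d r : ℕ) (k : Fin (3 * d)) : ℕ :=
  if (k : ℕ) < 3 * r ∧ (k : ℕ) % 3 ≠ 0 then 2 else 1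

/-- The order `<_r`. -/
noncomputable def order (d r : ℕ) : MonomialOrder (Fin (3 * d)) :=
  MonomialOrder.weightedLex (weight d r)

/-- The part of the Gröbner basis that comes from the first `r` blocks. -/
def basisA (d r : ℕ) : Set (MvPolynomial (Fin (3 * d)) K) :=
  ⋃ (i : Fin d) (_ : (i : ℕ) < r),
    {x K i 1 * x K i 2 - x K i 0 ^ 2,
     x K i 1 ^ 2 - x K i 0 * x K i 2,
     x K i 2 ^ 2 - x K i 0 * x K i 1}

/-- The part of the Gröbner basis that comes from the other blocks. -/
def basisB (d r : ℕ) : Set (MvPolynomial (Fin (3 * d)) K) :=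
  ⋃ (i : Fin d) (_ : r ≤ (i : ℕ)),
    {x K i 0 ^ 2 - x K i 1 * x K i 2,
     x K i 0 * x K i 1 - x K i 2 ^ 2,
     x K i 0 * x K i 2 - x K i 1 ^ 2,
     x K i 1 ^ 3 - x K i 2 ^ 3}

end TripleIdeal

attribute [local instance] MvPolynomial.gradedAlgebra

/-!
Attach to the variables `a = x i 0`, `b = x i 1`, `c = x i 2` of a block the degrees `(1, 1)`,
`(1, 2)`, `(1, 0)` in `ℕ × ℤ/3`. The generators `a² - bc`, `ab - c²`, `ac - b²` of a block are
differences of monomials of equal degree, and two monomials of equal degree are equal modulo them.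
Everything follows from this description of the quotient by a semigroup ring.

*Cohen–Macaulayness.* Let `P` be a maximal ideal of `S / I`. By the Nullstellensatz it contains
`f i (c i)` for monic polynomials `f i`, where `c i = x i 2`. These `d` elements form a regular
sequence: a quotient `Q` of `S` by the relations of block `i` and by elements that do not involve
that block embeds in `Q[ℤ/3][T]`, with the block variables sent to monomials and `c i` to `T`,
and a monic polynomial in `T` is a nonzerodivisor there (`mem_ker_of_aeval_mul_mem_ker`). Hence
the local ring at `P` has a regular sequence of length `d`, while its dimension is at most `d`,
because `S / I` is integral over the subring generated by the `c i`. Setting the variables of each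
block equal to one another maps `S / I` onto a polynomial ring in `d` variables, so the dimension
is exactly `d`.

*Gröbner basis.* The elements of `A ∪ B` are rewriting rules that replace a monomial by a smaller
one of the same degree. In each degree there is at most one monomial to which no rule applies
(`eq_of_grade_eq`), hence such a monomial is the least of its degree (`le_of_grade_eq`). An element of `I` maps
to zero in the semigroup ring, so its leading monomial shares its degree with another monomial of
its support and some rule applies to it.

*Depth.* The elements `x i 0`, `i < r`, form a regular sequence on `S / in(I)`. Modulo them, the
monomial with the factor `x i 1` for `i < r` and `x i 0` for `i ≥ r` is nonzero and is killed by all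
the variables. By the Rees theorem dividing by one regular element lowers the lengths of regular
sequences by one, so no regular sequence is longer than `r` (`length_le_of_socle`).
-/

universe u

/-! ### Regular sequences and socles -/

open RingTheory.Sequence CategoryTheory Abelian Pointwise in
/-- If `M` has a regular sequence of length `n + 1` in `J`, then `M / xM` has one of length `n`, for
every regular `x ∈ J`: read on the `Ext` groups `Ext i (R / J) M`, the hypothesis is their vanishing
for `i ≤ n`, and the long exact sequence of `x` gives that of `Ext i (R / J) (M / xM)` for `i < n`. -/
theorem exists_isRegular_quotSMulTop {R : Type u} [CommRing R] [IsNoetherianRing R]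
    (J : Ideal R) (M : Type u) [AddCommGroup M] [Module R M] [Module.Finite R M]
    (hJ : J • (⊤ : Submodule R M) ≠ ⊤) {x : R} (hx : IsSMulRegular M x)
    (hJx : J • (⊤ : Submodule R (QuotSMulTop x M)) ≠ ⊤)
    (n : ℕ) (h : ∃ rs : List R, rs.length = n + 1 ∧ (∀ a ∈ rs, a ∈ J) ∧ IsRegular M rs) :
    ∃ rs : List R, rs.length = n ∧ (∀ a ∈ rs, a ∈ J) ∧ IsRegular (QuotSMulTop x M) rs := by
  have h1 := ((ModuleCat.exists_isRegular_tfae J (n + 1) (ModuleCat.of R M) hJ.lt_top).out 1 3).2 h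
  refine ((ModuleCat.exists_isRegular_tfae J n (ModuleCat.of R (QuotSMulTop x M))
    hJx.lt_top).out 1 3).1 fun i hi => ?_
  have zero1 := AddCommGrpCat.isZero_of_iff_subsingleton.mpr (h1 i (by omega))
  have zero2 := AddCommGrpCat.isZero_of_iff_subsingleton.mpr (h1 (i + 1) (by omega))
  exact AddCommGrpCat.subsingleton_of_isZero <| ShortComplex.Exact.isZero_of_both_zeros
    ((Ext.covariant_sequence_exact₃' _
      (IsSMulRegular.smulShortComplex_shortExact (M := ModuleCat.of R M) hx)) i (i + 1) rfl)
    (zero1.eq_zero_of_src _) (zero2.eq_zero_of_tgt _)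

open RingTheory.Sequence Pointwise in
/-- If `rs` is a regular sequence in `J` and `J` kills a nonzero element of `M / (rs) M`, then no
regular sequence in `J` is longer than `rs`. -/
theorem length_le_of_socle {R : Type u} [CommRing R] [IsNoetherianRing R] (J : Ideal R)
    (rs : List R) (hrs : ∀ a ∈ rs, a ∈ J) (M : Type u) [AddCommGroup M] [Module R M]
    [Module.Finite R M] (hJ : J • (⊤ : Submodule R M) ≠ ⊤) (hreg : IsWeaklyRegular M rs) (m : M)
    (hm : m ∉ Ideal.ofList rs • (⊤ : Submodule R M))
    (hJm : ∀ a ∈ J, a • m ∈ Ideal.ofList rs • (⊤ : Submodule R M))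
    (rs' : List R) (hrs' : ∀ a ∈ rs', a ∈ J) (hreg' : IsRegular M rs') :
    rs'.length ≤ rs.length := by
  induction rs generalizing M rs' with
  | nil =>
    cases rs' with
    | nil => rfl
    | cons a t =>
      simp only [Ideal.ofList_nil, Submodule.bot_smul, Submodule.mem_bot] at hm hJm
      exact absurd (((isRegular_cons_iff M a t).1 hreg').1
        (by simpa using hJm a (hrs' a (by simp)))) hm
  | cons x t ih =>
    rw [isWeaklyRegular_cons_iff] at hreg
    have hxJ : x ∈ J := hrs x (by simp)
    have hJx : J • (⊤ : Submodule R (QuotSMulTop x M)) ≠ ⊤ := by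
      intro h
      apply hJ
      have := congrArg (Submodule.comap (Submodule.mkQ _)) h
      simpa [Submodule.comap_smul_top_of_surjective J _ (Submodule.mkQ_surjective _),
        Submodule.smul_mono_left ((Ideal.span_singleton_le_iff_mem J).mpr hxJ),
        ← Submodule.ideal_span_singleton_smul] using this
    have key : ∀ y : M, (Submodule.Quotient.mk y : QuotSMulTop x M) ∈
        Ideal.ofList t • (⊤ : Submodule R (QuotSMulTop x M)) ↔
        y ∈ Ideal.ofList (x :: t) • (⊤ : Submodule R M) := by
      intro y
      have h1 := Submodule.comap_smul_top_of_surjective (Ideal.ofList t)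
        (Submodule.mkQ (x • (⊤ : Submodule R M))) (Submodule.mkQ_surjective _)
      have h2 := SetLike.ext_iff.1 h1 y
      rw [Ideal.ofList_cons_smul]
      simpa [sup_comm] using h2
    cases rs' with
    | nil => simp
    | cons a t' =>
      obtain ⟨ss, hl, hss, hssreg⟩ := exists_isRegular_quotSMulTop J M hJ hreg.1 hJx t'.length
        ⟨a :: t', by simp, hrs', hreg'⟩
      have := ih (fun b hb => hrs b (by simp [hb])) (QuotSMulTop x M) hJx hreg.2
        (Submodule.Quotient.mk m) (by rwa [key])
        (fun b hb => by rw [← Submodule.Quotient.mk_smul, key]; exact hJm b hb) ss hss hssreg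
      simp; omega

theorem Ideal.mk_mem_smul_top_iff {S : Type*} [CommRing S] (I J : Ideal S) (p : S) :
    (Ideal.Quotient.mk I p : S ⧸ I) ∈ J • (⊤ : Submodule S (S ⧸ I)) ↔ p ∈ J ⊔ I := by
  simp

open RingTheory.Sequence in
theorem isWeaklyRegular_quotient_of_forall_mem {S : Type*} [CommRing S] (I : Ideal S) (ss : List S)
    (h : ∀ i (hi : i < ss.length) (p : S), ss[i] * p ∈ Ideal.ofList (ss.take i) ⊔ I →
      p ∈ Ideal.ofList (ss.take i) ⊔ I) :
    IsWeaklyRegular (S ⧸ I) ss := by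
  refine ⟨fun i hi => ?_⟩
  rw [isSMulRegular_quotient_iff_mem_of_smul_mem]
  intro y hy
  obtain ⟨p, rfl⟩ := Ideal.Quotient.mk_surjective y
  rw [Ideal.mk_mem_smul_top_iff]
  exact h i hi p ((Ideal.mk_mem_smul_top_iff _ _ _).1 hy)

/-! ### The block relations and the normal form of block monomials -/

namespace TripleIdeal

open MvPolynomial

/-- The index of the variable `x i j`. -/
def idx {d : ℕ} (i : Fin d) (j : Fin 3) : Fin (3 * d) := ⟨3 * (i : ℕ) + (j : ℕ), by omega⟩

theorem x_eq_X (K : Type*) [Field K] {d : ℕ} (i : Fin d) (j : Fin 3) : x K i j = X (idx i j) := rfl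

theorem idx_surjective {d : ℕ} (k : Fin (3 * d)) : ∃ i j, k = idx (d := d) i j :=
  ⟨⟨k / 3, by omega⟩, ⟨k % 3, by omega⟩, Fin.ext (by simp [idx]; omega)⟩

@[simp]
theorem idx_inj {d : ℕ} {i i' : Fin d} {j j' : Fin 3} :
    idx i j = idx i' j' ↔ i = i' ∧ j = j' := by
  simp only [idx, Fin.ext_iff]
  omega

section BlockNormalForm

variable {Q : Type*} [CommRing Q]

/-- The relations of a block, with its variables listed by their degree in `ℤ/3`: for
`v 0 = c`, `v 1 = a`, `v 2 = b` they are `a² = bc`, `ab = c²`, `b² = ac` and consequences of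
commutativity. -/
def BlockRelations (v : ZMod 3 → Q) : Prop := ∀ g h : ZMod 3, v g * v h = v (g + h) * v 0

/-- The common value of the block monomials of degree `(n, g)`. There is no monomial of degree
`(0, g)` with `g ≠ 0`, and the value `1` there is not used. -/
def blockNormalForm (v : ZMod 3 → Q) : ℕ → ZMod 3 → Q
  | 0, _ => 1
  | n + 1, g => v g * v 0 ^ n

theorem BlockRelations.mul_blockNormalForm {v : ZMod 3 → Q} (hv : BlockRelations v) (g : ZMod 3)
    (n : ℕ) (h : ZMod 3) (hn : n = 0 → h = 0) :
    v g * blockNormalForm v n h = blockNormalForm v (n + 1) (g + h) := by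
  cases n with
  | zero => simp [blockNormalForm, hn rfl]
  | succ n => simp only [blockNormalForm]; rw [← mul_assoc, hv]; ring

/-- The additive map `Q[ℤ/3][T] → Q` that sends `q g T ^ n` to `q` times the block monomial of
degree `(n, g)`. It is not multiplicative. -/
noncomputable def evalNormalForm (v : ZMod 3 → Q) :
    Polynomial (AddMonoidAlgebra Q (ZMod 3)) →+ Q where
  toFun y := y.sum fun n p => ∑ g, p.coeff g * blockNormalForm v n g
  map_zero' := by simp
  map_add' y z := by
    apply Polynomial.sum_add_index <;> simp [add_mul, Finset.sum_add_distrib]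

theorem evalNormalForm_monomial (v : ZMod 3 → Q) (n : ℕ) (g : ZMod 3) (q : Q) :
    evalNormalForm v (Polynomial.monomial n (AddMonoidAlgebra.single g q)) =
      q * blockNormalForm v n g := by
  simp only [evalNormalForm, AddMonoidHom.coe_mk, ZeroHom.coe_mk]
  rw [Polynomial.sum_monomial_index _ _ (by simp)]
  rw [Finset.sum_eq_single g] <;> simp +contextual [AddMonoidAlgebra.coeff_single]

end BlockNormalForm

variable (K : Type*) [Field K]

/-- Let the kernel of `π : S → Q` be generated by the relations of block `i` and by elements not
involving that block. Then monic polynomials in `x i 2` are nonzerodivisors on the image of `π`.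
The other variables are sent to constants of `Q[ℤ/3][T]` and those of block `i` to the monomials of
their degrees; this factors through the image of `π` and has `evalNormalForm` as a left inverse. -/
theorem mem_ker_of_aeval_mul_mem_ker {d : ℕ} (i : Fin d) (G : Set (MvPolynomial (Fin (3 * d)) K))
    (hG : ∀ g ∈ G, g ∈ Algebra.adjoin K {y | ∃ i' j, i' ≠ i ∧ y = x K i' j})
    {Q : Type*} [CommRing Q] [Algebra K Q] (π : MvPolynomial (Fin (3 * d)) K →ₐ[K] Q)
    (hπ : RingHom.ker π = Ideal.span (G ∪ {x K i 0 ^ 2 - x K i 1 * x K i 2,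
     x K i 0 * x K i 1 - x K i 2 ^ 2, x K i 0 * x K i 2 - x K i 1 ^ 2}))
    (f : Polynomial K) (hf : f.Monic) (p : MvPolynomial (Fin (3 * d)) K)
    (hp : π (Polynomial.aeval (x K i 2) f * p) = 0) : π p = 0 := by
  let v : ZMod 3 → Q := ![π (x K i 2), π (x K i 0), π (x K i 1)]
  have hx : ∀ j : Fin 3, π (x K i j) = v ((j : ℕ) + 1) := by
    intro j; fin_cases j <;> rfl
  have hv : BlockRelations v := by
    have h0 : x K i 0 ^ 2 - x K i 1 * x K i 2 ∈ RingHom.ker π :=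
      hπ ▸ Ideal.subset_span (by simp)
    have h1 : x K i 0 * x K i 1 - x K i 2 ^ 2 ∈ RingHom.ker π :=
      hπ ▸ Ideal.subset_span (by simp)
    have h2 : x K i 0 * x K i 2 - x K i 1 ^ 2 ∈ RingHom.ker π :=
      hπ ▸ Ideal.subset_span (by simp)
    simp only [RingHom.mem_ker, map_sub, map_mul, map_pow] at h0 h1 h2
    have e0 : v 0 = π (x K i 2) := rfl
    have e1 : v 1 = π (x K i 0) := rfl
    have e2 : v 2 = π (x K i 1) := rfl
    rw [← e0, ← e1, ← e2] at h0 h1 h2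
    intro g h
    fin_cases g <;> fin_cases h
    · rfl
    · change v 0 * v 1 = v 1 * v 0; ring
    · change v 0 * v 2 = v 2 * v 0; ring
    · change v 1 * v 0 = v 1 * v 0; ring
    · change v 1 * v 1 = v 2 * v 0; linear_combination h0
    · change v 1 * v 2 = v 0 * v 0; linear_combination h1
    · change v 2 * v 0 = v 2 * v 0; ring
    · change v 2 * v 1 = v 0 * v 0; linear_combination h1
    · change v 2 * v 2 = v 1 * v 0; linear_combination -h2
  let P := Polynomial (AddMonoidAlgebra Q (ZMod 3))
  let Φ : MvPolynomial (Fin (3 * d)) K →ₐ[K] P := MvPolynomial.aeval fun k : Fin (3 * d) =>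
    if (k : ℕ) / 3 = i then
      Polynomial.monomial 1 (AddMonoidAlgebra.single (((k % 3 : ℕ) : ZMod 3) + 1) 1)
    else Polynomial.monomial 0 (AddMonoidAlgebra.single 0 (π (X k)))
  let ι : Q →ₐ[K] P := IsScalarTower.toAlgHom K Q P
  have hι : ∀ q : Q, ι q = Polynomial.monomial 0 (AddMonoidAlgebra.single 0 q) := by
    intro q; rfl
  have hΦx : ∀ j : Fin 3, Φ (x K i j) =
      Polynomial.monomial 1 (AddMonoidAlgebra.single ((j : ℕ) + 1 : ZMod 3) 1) := by
    intro j
    have h1 : (3 * (i : ℕ) + j) / 3 = i := by omega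
    have h3 : (3 : ZMod 3) = 0 := rfl
    simp [Φ, x_eq_X, idx, h1, h3]
  have hΦxx : ∀ j j' : Fin 3, Φ (x K i j) * Φ (x K i j') = Polynomial.monomial 2
      (AddMonoidAlgebra.single (((j : ℕ) + 1 : ZMod 3) + ((j' : ℕ) + 1 : ZMod 3)) 1) := by
    intro j j'
    rw [hΦx, hΦx, Polynomial.monomial_mul_monomial, AddMonoidAlgebra.single_mul_single, mul_one]
  have hΦx' : ∀ i' (j : Fin 3), i' ≠ i → Φ (x K i' j) = ι (π (x K i' j)) := by
    intro i' j h
    have h1 : (3 * (i' : ℕ) + j) / 3 ≠ i := by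
      have := Fin.val_ne_of_ne h; omega
    rw [hι]
    simp [Φ, x_eq_X, idx, h1]
  have hΦG : ∀ g ∈ Algebra.adjoin K {y | ∃ i' j, i' ≠ i ∧ y = x K i' j},
      Φ g = (ι.comp π) g := by
    have : Set.EqOn Φ (ι.comp π) {y | ∃ i' j, i' ≠ i ∧ y = x K i' j} := by
      rintro _ ⟨i', j, h, rfl⟩
      exact hΦx' i' j h
    intro g hg
    exact (AlgHom.eqOn_adjoin_iff.2 this) hg
  have hΦJ : ∀ q ∈ RingHom.ker π, Φ q = 0 := by
    intro q hq
    suffices RingHom.ker π ≤ RingHom.ker Φ from this hq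
    rw [hπ, Ideal.span_le]
    rintro g (hg | hg)
    · have : π g = 0 := by
        rw [← RingHom.mem_ker, hπ]; exact Ideal.subset_span (Or.inl hg)
      simp [RingHom.mem_ker, hΦG g (hG g hg), this]
    · simp only [Set.mem_insert_iff, Set.mem_singleton_iff] at hg
      rw [SetLike.mem_coe, RingHom.mem_ker]
      rcases hg with rfl | rfl | rfl <;>
        simp only [map_sub, map_mul, hΦxx, sub_eq_zero, pow_two] <;> rfl
  -- a monomial of degree `(n, h)` in block `i` is a multiple of the normal form of that degree
  have hmon : ∀ (u : Fin (3 * d) →₀ ℕ) (a : K), ∃ (n : ℕ) (h : ZMod 3) (q : Q), (n = 0 → h = 0) ∧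
      Φ (monomial u a) = Polynomial.monomial n (AddMonoidAlgebra.single h q) ∧
      π (monomial u a) = q * blockNormalForm v n h := by
    intro u a
    apply MvPolynomial.induction_on_monomial (motive := fun p => ∃ (n : ℕ) (h : ZMod 3) (q : Q),
      (n = 0 → h = 0) ∧ Φ p = Polynomial.monomial n (AddMonoidAlgebra.single h q) ∧
      π p = q * blockNormalForm v n h)
    · intro a
      refine ⟨0, 0, π (C a), fun _ => rfl, ?_, by simp [blockNormalForm]⟩
      rw [← hι]
      have h1 : (C a : MvPolynomial (Fin (3 * d)) K) = algebraMap K _ a := rfl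
      rw [h1, AlgHom.commutes]
      exact (AlgHom.commutes (ι.comp π) a).symm
    · rintro p k ⟨n, h, q, hn, h1, h2⟩
      obtain ⟨i', j, rfl⟩ := idx_surjective k
      rw [← x_eq_X K, map_mul, map_mul, h1, h2]
      by_cases hi : i' = i
      · subst hi
        refine ⟨n + 1, h + ((j : ℕ) + 1), q, by simp, ?_, ?_⟩
        · rw [hΦx, Polynomial.monomial_mul_monomial, AddMonoidAlgebra.single_mul_single, mul_one]
        · rw [mul_assoc, mul_comm _ (π _), hx, hv.mul_blockNormalForm _ _ _ hn,
            add_comm h]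
      · refine ⟨n, h, q * π (x K i' j), hn, ?_, by ring⟩
        rw [hΦx' i' j hi, hι, Polynomial.monomial_mul_monomial, AddMonoidAlgebra.single_mul_single,
          add_zero, add_zero]
  have hinv : ∀ p, evalNormalForm v (Φ p) = π p := by
    intro p
    induction p using MvPolynomial.induction_on' with
    | monomial u a =>
      obtain ⟨n, h, q, -, h1, h2⟩ := hmon u a
      rw [h1, h2, evalNormalForm_monomial]
    | add p q hp hq => rw [map_add, map_add, map_add, hp, hq]
  have h0 := hΦJ _ hp
  have hΦf : Φ (Polynomial.aeval (x K i 2) f) =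
      f.map (algebraMap K (AddMonoidAlgebra Q (ZMod 3))) := by
    rw [← Polynomial.aeval_algHom_apply, hΦx]
    have : (Polynomial.monomial 1 (AddMonoidAlgebra.single (((2 : Fin 3) : ℕ) + 1 : ZMod 3) 1) : P)
      = Polynomial.X := rfl
    rw [this, Polynomial.aeval_X_left_eq_map]
  rw [map_mul, hΦf] at h0
  have h3 : Φ p = 0 := (hf.map (algebraMap K (AddMonoidAlgebra Q (ZMod 3)))).isRegular.left
    (by simpa using h0)
  rw [← hinv, h3, map_zero]

end TripleIdeal

/-! ### Cohen–Macaulayness and dimension -/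

open RingTheory.Sequence in
/-- A Noetherian local ring of dimension at most the length of one of its regular sequences is
Cohen–Macaulay. -/
theorem IsLocalRing.depthOn_eq_ringKrullDim_of_isRegular {R : Type*} [CommRing R] [IsLocalRing R]
    [IsNoetherianRing R] (rs : List R) (hrs : IsRegular R rs)
    (hdim : ringKrullDim R ≤ rs.length) :
    (((IsLocalRing.maximalIdeal R).depthOn R : ℕ∞) : WithBot ℕ∞) = ringKrullDim R := by
  have hlen : ∀ ss : List R, IsRegular R ss →
      ((ss.length : ℕ∞) : WithBot ℕ∞) ≤ ringKrullDim R := by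
    intro ss hss
    have : Nontrivial (R ⧸ Ideal.ofList ss) :=
      Ideal.Quotient.nontrivial_iff.2 fun h => hss.top_ne_smul (by simp [h])
    rw [← ringKrullDim_add_length_eq_ringKrullDim_of_isRegular ss hss]
    exact le_add_of_nonneg_left ringKrullDim_nonneg_of_nontrivial
  have hdim' : ringKrullDim R = ((rs.length : ℕ∞) : WithBot ℕ∞) := le_antisymm hdim (hlen rs hrs)
  rw [hdim', Ideal.depthOn, if_neg (by simpa using Ideal.IsPrime.ne_top inferInstance)]
  congr 1
  refine le_antisymm (sSup_le ?_) (le_sSup ⟨rs, fun a ha => ?_, hrs, rfl⟩)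
  · rintro _ ⟨ss, -, hss, rfl⟩
    exact WithBot.coe_le_coe.1 (hdim' ▸ hlen ss hss)
  · refine (IsLocalRing.mem_maximalIdeal a).2 fun hu => hrs.top_ne_smul ?_
    have : Ideal.ofList rs = ⊤ := Ideal.eq_top_of_isUnit_mem _ (Ideal.subset_span ha) hu
    simp [this]

/-- Primes in a strict chain have distinct contractions along an integral extension. -/
theorem ringKrullDim_le_of_isIntegral {A B : Type*} [CommRing A] [CommRing B] [Algebra A B]
    [Algebra.IsIntegral A B] : ringKrullDim B ≤ ringKrullDim A :=
  Order.krullDim_le_of_strictMono (PrimeSpectrum.comap (algebraMap A B)) fun _ _ h =>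
    Ideal.IsIntegral.comap_lt_comap h

namespace TripleIdeal

open MvPolynomial

variable (K : Type*) [Field K]

/-- Monic polynomials in `x 0 2`, …, `x (d - 1) 2`, one in each, form a weakly regular sequence on
`S / I`. -/
theorem isWeaklyRegular_aeval {d : ℕ} (f : Fin d → Polynomial K) (hf : ∀ i, (f i).Monic) :
    RingTheory.Sequence.IsWeaklyRegular (MvPolynomial (Fin (3 * d)) K ⧸ ideal K d)
      (List.ofFn fun i : Fin d => Polynomial.aeval (x K i 2) (f i)) := by
  apply isWeaklyRegular_quotient_of_forall_mem
  intro n hn p hp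
  set J := Ideal.ofList ((List.ofFn fun i : Fin d => Polynomial.aeval (x K i 2) (f i)).take n) ⊔
    ideal K d with hJ
  have hn' : n < d := by simpa using hn
  rw [← Ideal.Quotient.eq_zero_iff_mem] at hp ⊢
  rw [List.getElem_ofFn] at hp
  refine mem_ker_of_aeval_mul_mem_ker K ⟨n, hn'⟩
    ({g | ∃ j : Fin d, (j : ℕ) < n ∧ g = Polynomial.aeval (x K j 2) (f j)} ∪
    ⋃ (i : Fin d) (_ : i ≠ ⟨n, hn'⟩), {x K i 0 ^ 2 - x K i 1 * x K i 2,
     x K i 0 * x K i 1 - x K i 2 ^ 2,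
     x K i 0 * x K i 2 - x K i 1 ^ 2}) ?_ (Ideal.Quotient.mkₐ K J) ?_ (f ⟨n, hn'⟩) (hf _) p hp
  · have hx : ∀ (i : Fin d) (j : Fin 3), i ≠ ⟨n, hn'⟩ →
        x K i j ∈ Algebra.adjoin K {y | ∃ (i' : Fin d) (j : Fin 3), i' ≠ ⟨n, hn'⟩ ∧ y = x K i' j} :=
      fun i j h => Algebra.subset_adjoin ⟨i, j, h, rfl⟩
    rintro g (⟨j, hj, rfl⟩ | hg)
    · refine (Algebra.adjoin_le ?_) (Polynomial.aeval_mem_adjoin_singleton K _)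
      rintro _ rfl
      exact hx j 2 (Fin.ne_of_val_ne (by simpa using hj.ne))
    · simp only [Set.mem_iUnion, Set.mem_insert_iff, Set.mem_singleton_iff] at hg
      obtain ⟨i, hi, rfl | rfl | rfl⟩ := hg
      · exact sub_mem (pow_mem (hx i 0 hi) 2) (mul_mem (hx i 1 hi) (hx i 2 hi))
      · exact sub_mem (mul_mem (hx i 0 hi) (hx i 1 hi)) (pow_mem (hx i 2 hi) 2)
      · exact sub_mem (mul_mem (hx i 0 hi) (hx i 2 hi)) (pow_mem (hx i 1 hi) 2)
  · have h1 : RingHom.ker (Ideal.Quotient.mkₐ K J) = J := Ideal.Quotient.mkₐ_ker K J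
    rw [h1, hJ, Ideal.ofList, ideal, ← Ideal.span_union, Set.union_assoc]
    congr 2
    · ext g
      simp only [Set.mem_ofPred_eq, List.mem_take_iff_getElem, List.length_ofFn, List.getElem_ofFn]
      constructor
      · rintro ⟨j, hj, rfl⟩; exact ⟨⟨j, by omega⟩, by simp; omega, rfl⟩
      · rintro ⟨j, hj, rfl⟩; exact ⟨j, by omega, rfl⟩
    · ext g
      simp only [Set.mem_iUnion, Set.mem_union]
      constructor
      · rintro ⟨i, hi⟩
        by_cases h : i = ⟨n, hn'⟩
        · subst h; exact Or.inr hi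
        · exact Or.inl ⟨i, h, hi⟩
      · rintro (⟨i, -, hi⟩ | hi)
        · exact ⟨i, hi⟩
        · exact ⟨_, hi⟩

theorem relations_quotient {d : ℕ} (i : Fin d) :
    let y := fun j => Ideal.Quotient.mk (ideal K d) (x K i j)
    y 0 ^ 2 = y 1 * y 2 ∧ y 0 * y 1 = y 2 ^ 2 ∧ y 0 * y 2 = y 1 ^ 2 := by
  simp only [← map_mul, ← map_pow, Ideal.Quotient.eq]
  refine ⟨?_, ?_, ?_⟩ <;> exact Ideal.subset_span (Set.mem_iUnion.2 ⟨i, by simp⟩)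

theorem ringKrullDim_quotient_le (d : ℕ) :
    ringKrullDim (MvPolynomial (Fin (3 * d)) K ⧸ ideal K d) ≤ (d : WithBot ℕ∞) := by
  let φ : MvPolynomial (Fin d) K →ₐ[K] MvPolynomial (Fin (3 * d)) K ⧸ ideal K d :=
    aeval fun i => Ideal.Quotient.mk (ideal K d) (x K i 2)
  algebraize [φ.toRingHom]
  have hφ : ∀ q, IsIntegral (MvPolynomial (Fin d) K) (φ q) := fun q => isIntegral_algebraMap
  have h2 : ∀ i, φ (X i) = Ideal.Quotient.mk (ideal K d) (x K i 2) := fun i => aeval_X _ _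
  have hint : Algebra.IsIntegral (MvPolynomial (Fin d) K)
      (MvPolynomial (Fin (3 * d)) K ⧸ ideal K d) := by
    refine ⟨fun q => ?_⟩
    obtain ⟨p, rfl⟩ := Ideal.Quotient.mk_surjective q
    induction p using MvPolynomial.induction_on with
    | C a =>
      have := hφ (C a)
      rwa [← algebraMap_eq, φ.commutes] at this
    | add p q hp hq => rw [map_add]; exact hp.add hq
    | mul_X p k hp =>
      rw [map_mul]
      refine hp.mul ?_
      obtain ⟨i, j, rfl⟩ := idx_surjective k
      rw [← x_eq_X K]
      obtain ⟨r0, r1, r2⟩ := relations_quotient K i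
      have hc := hφ (X i)
      rw [h2] at hc
      have h0 : IsIntegral (MvPolynomial (Fin d) K) (Ideal.Quotient.mk (ideal K d) (x K i 0)) := by
        refine IsIntegral.of_pow (n := 3) (by norm_num) ?_
        -- `a³ = a (bc) = (ab) c = c³`
        have : (Ideal.Quotient.mk (ideal K d) (x K i 0)) ^ 3 =
          (Ideal.Quotient.mk (ideal K d) (x K i 2)) ^ 3 := by
          linear_combination (Ideal.Quotient.mk (ideal K d) (x K i 0)) * r0 +
            (Ideal.Quotient.mk (ideal K d) (x K i 2)) * r1
        rw [this]
        exact hc.pow 3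
      have h1 : IsIntegral (MvPolynomial (Fin d) K) (Ideal.Quotient.mk (ideal K d) (x K i 1)) := by
        -- `b² = ac`
        refine IsIntegral.of_pow (n := 2) (by norm_num) ?_
        rw [← r2]
        exact h0.mul hc
      fin_cases j
      · exact h0
      · exact h1
      · exact hc
  refine ringKrullDim_le_of_isIntegral.trans
    (MvPolynomial.ringKrullDim_of_isNoetherianRing (R := K) (ι := Fin d)).le |>.trans ?_
  simp

theorem le_ringKrullDim_quotient (d : ℕ) :
    (d : WithBot ℕ∞) ≤ ringKrullDim (MvPolynomial (Fin (3 * d)) K ⧸ ideal K d) := by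
  let φ : MvPolynomial (Fin (3 * d)) K →ₐ[K] MvPolynomial (Fin d) K :=
    aeval fun k : Fin (3 * d) => X ⟨(k : ℕ) / 3, by omega⟩
  have hφ : ∀ (i : Fin d) j, φ (x K i j) = X i := by
    intro i j
    simp only [φ, x, aeval_X]
    congr 1
    ext
    simp; omega
  have hI : ∀ p ∈ ideal K d, φ p = 0 := by
    intro q hq
    suffices ideal K d ≤ RingHom.ker φ from this hq
    rw [ideal, Ideal.span_le]
    rintro g hg
    simp only [Set.mem_iUnion, Set.mem_insert_iff, Set.mem_singleton_iff] at hg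
    rw [SetLike.mem_coe, RingHom.mem_ker]
    obtain ⟨i, rfl | rfl | rfl⟩ := hg <;> simp [hφ] <;> ring
  have hsurj : Function.Surjective (Ideal.Quotient.lift (ideal K d) φ.toRingHom hI) := by
    apply Ideal.Quotient.lift_surjective_of_surjective
    intro q
    exact ⟨aeval (fun i => x K i 2) q, by
      change (φ.comp (aeval fun i => x K i 2)) q = AlgHom.id K _ q
      congr 1
      ext i
      simp [hφ]⟩
  refine le_trans ?_ (ringKrullDim_le_of_surjective _ hsurj)
  rw [MvPolynomial.ringKrullDim_of_isNoetherianRing]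
  simp

theorem isCohenMacaulayRing_quotient (d : ℕ) :
    IsCohenMacaulayRing (MvPolynomial (Fin (3 * d)) K ⧸ ideal K d) := by
  refine ⟨inferInstance, fun P hP => ?_⟩
  let := Ideal.Quotient.field P
  have := finite_of_finite_type_of_isJacobsonRing K
    ((MvPolynomial (Fin (3 * d)) K ⧸ ideal K d) ⧸ P)
  -- the residue field is finite over `K`, so the class of `x i 2` in it is algebraic
  have hf : ∀ i : Fin d, ∃ f : Polynomial K, f.Monic ∧
      Ideal.Quotient.mk (ideal K d) (Polynomial.aeval (x K i 2) f) ∈ P := by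
    intro i
    obtain ⟨f, hf, h⟩ := Algebra.IsIntegral.isIntegral (R := K)
      (Ideal.Quotient.mk P (Ideal.Quotient.mk (ideal K d) (x K i 2)))
    refine ⟨f, hf, ?_⟩
    rw [← Ideal.Quotient.eq_zero_iff_mem]
    rw [← Polynomial.aeval_def] at h
    have h1 := Polynomial.aeval_algHom_apply
      ((Ideal.Quotient.mkₐ K P).comp (Ideal.Quotient.mkₐ K (ideal K d))) (x K i 2) f
    exact h1.symm.trans h
  choose f hf hfP using hf
  have hreg := isWeaklyRegular_aeval K f hf
  rw [← RingTheory.Sequence.isWeaklyRegular_map_algebraMap_iff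
    (MvPolynomial (Fin (3 * d)) K ⧸ ideal K d)] at hreg
  refine IsLocalRing.depthOn_eq_ringKrullDim_of_isRegular _
    (hreg.isRegular_of_isLocalization_of_mem (Localization.AtPrime P) P ?_) ?_
  · simp only [List.mem_map, List.mem_ofFn]
    rintro _ ⟨_, ⟨i, rfl⟩, rfl⟩
    exact hfP i
  · rw [IsLocalization.AtPrime.ringKrullDim_eq_height P]
    refine (Ideal.height_le_ringKrullDim_of_ne_top hP.ne_top).trans ?_
    simpa using ringKrullDim_quotient_le K d

end TripleIdeal

/-! ### The initial ideal and the Gröbner bases -/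

namespace TripleIdeal

open MvPolynomial

/-- The exponent of the monomial `∏ j, x i j ^ e j` of block `i`. -/
noncomputable def blockExp {d : ℕ} (i : Fin d) (e : Fin 3 → ℕ) : Fin (3 * d) →₀ ℕ :=
  ∑ j, Finsupp.single (idx i j) (e j)

theorem blockExp_idx {d : ℕ} (i i' : Fin d) (e : Fin 3 → ℕ) (j : Fin 3) :
    blockExp i e (idx i' j) = if i = i' then e j else 0 := by
  simp only [blockExp, Finsupp.coe_finsetSum, Finset.sum_apply, Finsupp.single_apply, idx_inj]
  by_cases h : i = i' <;> simp [h]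

theorem blockExp_le_iff {d : ℕ} (i : Fin d) (e : Fin 3 → ℕ) (u : Fin (3 * d) →₀ ℕ) :
    blockExp i e ≤ u ↔ ∀ j, e j ≤ u (idx i j) := by
  constructor
  · intro h j
    simpa [blockExp_idx] using h (idx i j)
  · intro h k
    obtain ⟨i', j, rfl⟩ := idx_surjective k
    rw [blockExp_idx]
    split_ifs with hi
    · exact hi ▸ h j
    · exact Nat.zero_le _

theorem monomial_blockExp (K : Type*) [Field K] {d : ℕ} (i : Fin d) (e : Fin 3 → ℕ) :
    monomial (blockExp i e) (1 : K) = x K i 0 ^ e 0 * x K i 1 ^ e 1 * x K i 2 ^ e 2 := by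
  simp only [blockExp, Fin.sum_univ_three, x_eq_X, X_pow_eq_monomial, monomial_mul, one_mul]

/-- The rewriting rules of a block, as pairs (leading exponent, other exponent): those of the
elements of `basisA` if `p` holds (used with `p` the condition `i < r` on the block `i`), and those
of the elements of `basisB` otherwise. -/
def rules (p : Prop) [Decidable p] : List ((Fin 3 → ℕ) × (Fin 3 → ℕ)) :=
  if p then [(![0, 1, 1], ![2, 0, 0]), (![0, 2, 0], ![1, 0, 1]), (![0, 0, 2], ![1, 1, 0])]
  else [(![2, 0, 0], ![0, 1, 1]), (![1, 1, 0], ![0, 0, 2]), (![1, 0, 1], ![0, 2, 0]),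
    (![0, 3, 0], ![0, 0, 3])]

theorem basis_union_eq (K : Type*) [Field K] (d r : ℕ) :
    basisA K d r ∪ basisB K d r = {g | ∃ i : Fin d, ∃ ρ ∈ rules ((i : ℕ) < r),
      g = monomial (blockExp i ρ.1) 1 - monomial (blockExp i ρ.2) 1} := by
  ext g
  simp only [basisA, basisB, Set.mem_union, Set.mem_iUnion, Set.mem_insert_iff,
    Set.mem_singleton_iff, Set.mem_ofPred_eq]
  rw [← exists_or]
  refine exists_congr fun i => ?_
  by_cases h : (i : ℕ) < r
  · simp [h, rules, monomial_blockExp, not_le.2 h]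
  · simp [h, rules, monomial_blockExp, not_lt.1 h]

theorem weight_blockExp {d : ℕ} (r : ℕ) (i : Fin d) (e : Fin 3 → ℕ) :
    Finsupp.weight (weight d r) (blockExp i e) =
      if (i : ℕ) < r then e 0 + 2 * e 1 + 2 * e 2 else e 0 + e 1 + e 2 := by
  have h1 : ∀ j : Fin 3, weight d r (idx i j) = if (i : ℕ) < r ∧ j ≠ 0 then 2 else 1 := by
    intro j
    simp only [weight, idx]
    congr 1
    simp only [ne_eq, Fin.ext_iff, Fin.val_zero, eq_iff_iff]
    omega
  simp only [blockExp, Fin.sum_univ_three, map_add, Finsupp.weight_single, h1]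
  by_cases h : (i : ℕ) < r <;> simp [h, mul_comm]

theorem toLex_blockExp_lt {d : ℕ} (i : Fin d) (e e' : Fin 3 → ℕ) (h : toLex e < toLex e') :
    toLex (blockExp i e) < toLex (blockExp i e') := by
  obtain ⟨j, h1, h2⟩ := h
  refine ⟨idx i j, fun k hk => ?_, ?_⟩
  · obtain ⟨i', j', rfl⟩ := idx_surjective k
    change blockExp i e _ = blockExp i e' _
    rw [blockExp_idx, blockExp_idx]
    split_ifs with hi
    · subst hi
      exact h1 j' (by simp only [idx, Fin.lt_def] at hk ⊢; omega)
    · rfl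
  · change blockExp i e _ < blockExp i e' _
    simpa [blockExp_idx] using h2

open scoped MonomialOrder

theorem rules_lt {d : ℕ} (r : ℕ) (i : Fin d) (ρ) (hρ : ρ ∈ rules ((i : ℕ) < r)) :
    blockExp i ρ.2 ≺[order d r] blockExp i ρ.1 := by
  rw [order, MonomialOrder.weightedLex_lt_iff, weight_blockExp, weight_blockExp]
  have key : ∀ e e' : Fin 3 → ℕ, (e 0 < e' 0 ∨ e 0 = e' 0 ∧ e 1 < e' 1) → toLex e < toLex e' := by
    rintro e e' (h | ⟨h, h'⟩)
    · exact ⟨0, by simp, h⟩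
    · refine ⟨1, fun j hj => ?_, h'⟩
      obtain rfl : j = 0 := by omega
      exact h
  by_cases h : (i : ℕ) < r
  · left
    simp only [rules, h, if_true, List.mem_cons, List.not_mem_nil, or_false] at hρ ⊢
    rcases hρ with rfl | rfl | rfl <;> simp
  -- the weights agree here, and the lexicographic order decides
  · right
    simp only [rules, h, if_false, List.mem_cons, List.not_mem_nil, or_false] at hρ ⊢
    rcases hρ with rfl | rfl | rfl | rfl <;>
      refine ⟨by simp, toLex_blockExp_lt _ _ _ (key _ _ (by simp))⟩

/-- The multidegree of an exponent: for each block the total degree, and the degree modulo `3` for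
which `x i 0`, `x i 1`, `x i 2` have degrees `1`, `2`, `0`. -/
def grade (d : ℕ) : (Fin (3 * d) →₀ ℕ) →+ (Fin d → ℕ × ZMod 3) where
  toFun u i := (u (idx i 0) + u (idx i 1) + u (idx i 2),
    ((u (idx i 0) + 2 * u (idx i 1) : ℕ) : ZMod 3))
  map_zero' := by ext <;> simp
  map_add' u v := by ext i <;> simp <;> ring

theorem grade_eq_iff {d : ℕ} (u v : Fin (3 * d) →₀ ℕ) : grade d u = grade d v ↔ ∀ i,
    u (idx i 0) + u (idx i 1) + u (idx i 2) = v (idx i 0) + v (idx i 1) + v (idx i 2) ∧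
    (u (idx i 0) + 2 * u (idx i 1)) % 3 = (v (idx i 0) + 2 * v (idx i 1)) % 3 := by
  simp only [grade, AddMonoidHom.coe_mk, ZeroHom.coe_mk, funext_iff, Prod.mk.injEq,
    ZMod.natCast_eq_natCast_iff']

theorem grade_blockExp_eq {d : ℕ} (i : Fin d) (p : Prop) [Decidable p] (ρ) (hρ : ρ ∈ rules p) :
    grade d (blockExp i ρ.1) = grade d (blockExp i ρ.2) := by
  rw [grade_eq_iff]
  intro i'
  simp only [blockExp_idx]
  by_cases hi : i = i'
  · simp only [hi, if_true]
    by_cases h : p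
    · simp only [rules, h, if_true, List.mem_cons, List.not_mem_nil, or_false] at hρ ⊢
      rcases hρ with rfl | rfl | rfl <;> simp
    · simp only [rules, h, if_false, List.mem_cons, List.not_mem_nil, or_false] at hρ ⊢
      rcases hρ with rfl | rfl | rfl | rfl <;> simp
  · simp [hi]

/-- The exponents of the leading monomials of `basisA ∪ basisB`. -/
def leadingExps (d r : ℕ) : Set (Fin (3 * d) →₀ ℕ) :=
  {u | ∃ i : Fin d, ∃ ρ ∈ rules ((i : ℕ) < r), u = blockExp i ρ.1}

/-- A multidegree contains at most one monomial that is divisible by no leading monomial. -/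
theorem eq_of_grade_eq {d r : ℕ} (u v : Fin (3 * d) →₀ ℕ)
    (hu : ∀ s ∈ leadingExps d r, ¬ s ≤ u) (hv : ∀ s ∈ leadingExps d r, ¬ s ≤ v)
    (h : grade d u = grade d v) : u = v := by
  rw [grade_eq_iff] at h
  have key : ∀ i, u (idx i 0) = v (idx i 0) ∧ u (idx i 1) = v (idx i 1) ∧
      u (idx i 2) = v (idx i 2) := by
    intro i
    have aux : ∀ w : Fin (3 * d) →₀ ℕ, (∀ s ∈ leadingExps d r, ¬ s ≤ w) →
        ∀ ρ ∈ rules ((i : ℕ) < r), ¬ (ρ.1 0 ≤ w (idx i 0) ∧ ρ.1 1 ≤ w (idx i 1) ∧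
          ρ.1 2 ≤ w (idx i 2)) := by
      rintro w hw ρ hρ ⟨h0, h1, h2⟩
      refine hw _ ⟨i, ρ, hρ, rfl⟩ ((blockExp_le_iff _ _ _).2 fun j => ?_)
      fin_cases j <;> assumption
    have hu' := aux u hu
    have hv' := aux v hv
    obtain ⟨h1, h2⟩ := h i
    by_cases hi : (i : ℕ) < r <;> simp [rules, hi, -not_and] at hu' hv'
    all_goals
      clear hu hv h aux
      generalize u (idx i 0) = a at *
      generalize u (idx i 1) = b at *
      generalize u (idx i 2) = c at *
      generalize v (idx i 0) = a' at *
      generalize v (idx i 1) = b' at *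
      generalize v (idx i 2) = c' at *
    · obtain ⟨hu, hb, hc⟩ := hu'
      obtain ⟨hv, hb', hc'⟩ := hv'
      interval_cases b <;> interval_cases b' <;> interval_cases c <;> interval_cases c' <;> omega
    · obtain ⟨ha, hu1, hu2, hb⟩ := hu'
      obtain ⟨ha', hv1, hv2, hb'⟩ := hv'
      interval_cases a <;> interval_cases a' <;> interval_cases b <;> interval_cases b' <;> omega
  ext k
  obtain ⟨i, j, rfl⟩ := idx_surjective k
  obtain ⟨h0, h1, h2⟩ := key i
  fin_cases j
  · exact h0
  · exact h1
  · exact h2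

/-- A monomial divisible by no leading monomial is the least one of its multidegree: any other
monomial can be rewritten to a smaller one of the same multidegree. -/
theorem le_of_grade_eq {d r : ℕ} (u v : Fin (3 * d) →₀ ℕ)
    (hu : ∀ s ∈ leadingExps d r, ¬ s ≤ u) (h : grade d u = grade d v) : u ≼[order d r] v := by
  induction hv' : (order d r).toSyn v using WellFoundedLT.induction generalizing v with
  | ind a ih =>
    subst hv'
    by_cases hv : ∀ s ∈ leadingExps d r, ¬ s ≤ v
    · rw [eq_of_grade_eq u v hu hv h]
    · push Not at hv
      obtain ⟨_, ⟨i, ρ, hρ, rfl⟩, hs⟩ := hv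
      obtain ⟨w, rfl⟩ := le_iff_exists_add.1 hs
      have hlt : blockExp i ρ.2 + w ≺[order d r] blockExp i ρ.1 + w := by
        simpa using rules_lt r i ρ hρ
      refine (ih _ hlt _ ?_ rfl).trans hlt.le
      rw [h, map_add, map_add, grade_blockExp_eq i _ ρ hρ]

variable (K : Type*) [Field K]

/-- The homomorphism to the semigroup ring that sends a monomial to its multidegree. -/
noncomputable def gradeHom (d : ℕ) :
    MvPolynomial (Fin (3 * d)) K →ₐ[K] AddMonoidAlgebra K (Fin d → ℕ × ZMod 3) :=
  AddMonoidAlgebra.mapDomainAlgHom K K (grade d)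

theorem gradeHom_monomial (d : ℕ) (u : Fin (3 * d) →₀ ℕ) (a : K) :
    gradeHom K d (monomial u a) = AddMonoidAlgebra.single (grade d u) a := by
  simp [gradeHom, ← MvPolynomial.single_eq_monomial]

theorem gradeHom_eq_zero {d : ℕ} {f : MvPolynomial (Fin (3 * d)) K} (hf : f ∈ ideal K d) :
    gradeHom K d f = 0 := by
  suffices ideal K d ≤ RingHom.ker (gradeHom K d) from this hf
  rw [ideal, Ideal.span_le]
  intro g hg
  -- for `r = 0` all the generators of the ideal are in `basisB`
  have hg' : g ∈ basisA K d 0 ∪ basisB K d 0 := by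
    right
    simp only [Set.mem_iUnion, Set.mem_insert_iff, Set.mem_singleton_iff, basisB] at hg ⊢
    obtain ⟨i, hg⟩ := hg
    exact ⟨i, Nat.zero_le _, by tauto⟩
  rw [basis_union_eq] at hg'
  obtain ⟨i, ρ, hρ, rfl⟩ := hg'
  rw [SetLike.mem_coe, RingHom.mem_ker, map_sub, gradeHom_monomial, gradeHom_monomial,
    grade_blockExp_eq i _ ρ hρ, sub_self]

theorem basis_subset_ideal (d r : ℕ) :
    basisA K d r ∪ basisB K d r ⊆ (ideal K d : Set (MvPolynomial (Fin (3 * d)) K)) := by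
  have hI : ∀ (i : Fin d) (g), g ∈ ({x K i 0 ^ 2 - x K i 1 * x K i 2,
     x K i 0 * x K i 1 - x K i 2 ^ 2,
     x K i 0 * x K i 2 - x K i 1 ^ 2} : Set _) → g ∈ ideal K d := fun i g hg =>
    Ideal.subset_span (Set.mem_iUnion.2 ⟨i, hg⟩)
  rintro g (hg | hg)
  · simp only [basisA, Set.mem_iUnion, Set.mem_insert_iff, Set.mem_singleton_iff] at hg
    obtain ⟨i, -, rfl | rfl | rfl⟩ := hg
    · exact (Submodule.neg_mem_iff _).1 (hI i _ (by simp))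
    · exact (Submodule.neg_mem_iff _).1 (hI i _ (by simp))
    · exact (Submodule.neg_mem_iff _).1 (hI i _ (by simp))
  · simp only [basisB, Set.mem_iUnion, Set.mem_insert_iff, Set.mem_singleton_iff] at hg
    obtain ⟨i, -, rfl | rfl | rfl | rfl⟩ := hg
    · exact hI i _ (by simp)
    · exact hI i _ (by simp)
    · exact hI i _ (by simp)
    · have h1 := hI i (x K i 0 * x K i 1 - x K i 2 ^ 2) (by simp)
      have h2 := hI i (x K i 0 * x K i 2 - x K i 1 ^ 2) (by simp)
      have : x K i 1 ^ 3 - x K i 2 ^ 3 = x K i 2 * (x K i 0 * x K i 1 - x K i 2 ^ 2) -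
        x K i 1 * (x K i 0 * x K i 2 - x K i 1 ^ 2) := by ring
      rw [SetLike.mem_coe, this]
      exact sub_mem (Ideal.mul_mem_left _ _ h1) (Ideal.mul_mem_left _ _ h2)

theorem exists_leadingExps_le_degree {d r : ℕ} {f : MvPolynomial (Fin (3 * d)) K}
    (hf : f ∈ ideal K d) (hf0 : f ≠ 0) : ∃ s ∈ leadingExps d r, s ≤ (order d r).degree f := by
  by_contra! hu
  set u := (order d r).degree f with hu_def
  have h0 := gradeHom_eq_zero K hf
  rw [f.as_sum, map_sum] at h0
  have h1 := congrArg (fun y => y.coeff (grade d u)) h0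
  simp only [gradeHom_monomial, AddMonoidAlgebra.coeff_sum, AddMonoidAlgebra.coeff_single,
    Finsupp.coe_finsetSum, Finset.sum_apply, Finsupp.single_apply,
    AddMonoidAlgebra.coeff_zero, Finsupp.coe_zero, Pi.zero_apply] at h1
  rw [Finset.sum_eq_single u] at h1
  · rw [if_pos rfl] at h1
    exact (order d r).coeff_degree_ne_zero_iff.2 hf0 h1
  -- no other monomial of the support shares the multidegree of `u`, which is least there
  · intro v hv hvu
    rw [if_neg]
    intro h
    apply hvu
    have h2 : v ≼[order d r] u := (order d r).le_degree hv
    have h3 : u ≼[order d r] v := le_of_grade_eq u v hu h.symm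
    exact (order d r).toSyn.injective (le_antisymm h2 h3)
  · intro h
    rw [if_pos rfl]
    exact notMem_support_iff.1 h

theorem degree_monomial_sub {d r : ℕ} {u v : Fin (3 * d) →₀ ℕ} (h : v ≺[order d r] u) :
    (order d r).degree (monomial u 1 - monomial v 1 : MvPolynomial (Fin (3 * d)) K) = u := by
  classical
  rw [MonomialOrder.degree_sub_of_lt] <;> simp [MonomialOrder.degree_monomial, h]

theorem initialIdeal_eq (d r : ℕ) : (order d r).initialIdeal (ideal K d) =
    Ideal.span ((fun s => monomial s (1 : K)) '' leadingExps d r) := by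
  apply le_antisymm
  · refine Ideal.span_le.2 ?_
    rintro _ ⟨f, hf, hf0, rfl⟩
    obtain ⟨s, hs, hle⟩ := exists_leadingExps_le_degree K (r := r) hf hf0
    obtain ⟨w, hw⟩ := le_iff_exists_add.1 hle
    rw [hw, add_comm, ← one_mul (1 : K), ← monomial_mul, one_mul]
    exact Ideal.mul_mem_left _ _ (Ideal.subset_span ⟨s, hs, rfl⟩)
  · refine Ideal.span_le.2 ?_
    rintro _ ⟨_, ⟨i, ρ, hρ, rfl⟩, rfl⟩
    have h := degree_monomial_sub K (rules_lt r i ρ hρ)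
    refine Ideal.subset_span ⟨monomial (blockExp i ρ.1) 1 - monomial (blockExp i ρ.2) 1,
      basis_subset_ideal K d r ?_, ?_, ?_⟩
    · rw [basis_union_eq]
      exact ⟨i, ρ, hρ, rfl⟩
    · rw [sub_ne_zero, Ne, monomial_left_inj one_ne_zero]
      intro h'
      have := rules_lt r i ρ hρ
      rw [h'] at this
      exact lt_irrefl _ this
    · rw [h]

theorem isGroebnerBasis (d r : ℕ) :
    (order d r).IsGroebnerBasis (basisA K d r ∪ basisB K d r) (ideal K d) := by
  refine ⟨?_, ?_, basis_subset_ideal K d r, ?_⟩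
  · refine Set.Finite.union ?_ ?_
    · exact Set.finite_iUnion fun i => Set.finite_iUnion fun _ => by simp
    · exact Set.finite_iUnion fun i => Set.finite_iUnion fun _ => by simp
  · intro g hg
    rw [basis_union_eq] at hg
    obtain ⟨i, ρ, hρ, rfl⟩ := hg
    rw [sub_ne_zero, Ne, monomial_left_inj one_ne_zero]
    intro h'
    have := rules_lt r i ρ hρ
    rw [h'] at this
    exact lt_irrefl _ this
  · rw [initialIdeal_eq, basis_union_eq]
    congr 1
    ext y
    constructor
    · rintro ⟨_, ⟨i, ρ, hρ, rfl⟩, rfl⟩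
      exact ⟨_, ⟨i, ρ, hρ, rfl⟩, by rw [degree_monomial_sub K (rules_lt r i ρ hρ)]⟩
    · rintro ⟨_, ⟨i, ρ, hρ, rfl⟩, rfl⟩
      exact ⟨_, ⟨i, ρ, hρ, rfl⟩, by rw [degree_monomial_sub K (rules_lt r i ρ hρ)]⟩

end TripleIdeal

/-! ### The depth of the initial ideal -/

/-- A variable that occurs in no generator of a monomial ideal is regular modulo the ideal. -/
theorem MvPolynomial.mem_span_monomial_of_X_mul_mem {σ R : Type*} [CommSemiring R]
    {E : Set (σ →₀ ℕ)} {k : σ} (hE : ∀ s ∈ E, s k = 0) {p : MvPolynomial σ R}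
    (hp : X k * p ∈ Ideal.span ((fun s => monomial s (1 : R)) '' E)) :
    p ∈ Ideal.span ((fun s => monomial s (1 : R)) '' E) := by
  classical
  rw [mem_ideal_span_monomial_image] at hp ⊢
  intro u hu
  obtain ⟨s, hs, hle⟩ := hp (Finsupp.single k 1 + u) (by
    rw [mem_support_iff, coeff_X_mul]
    exact mem_support_iff.1 hu)
  refine ⟨s, hs, fun l => ?_⟩
  by_cases hl : l = k
  · subst hl
    simp [hE s hs]
  · simpa [Finsupp.single_apply, Ne.symm hl] using hle l

namespace TripleIdeal

open MvPolynomial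

variable (K : Type*) [Field K]

/-- Exponents that generate the ideal `in(I) + (x j 0 : j < n)`. -/
def extendedExps (d r n : ℕ) : Set (Fin (3 * d) →₀ ℕ) :=
  {s | ∃ j : Fin d, (j : ℕ) < n ∧ s = Finsupp.single (idx j 0) 1} ∪ leadingExps d r

theorem ofList_sup_initialIdeal {d r n : ℕ} (hr : r ≤ d) (hn : n ≤ r) :
    Ideal.ofList ((List.ofFn fun i : Fin r => x K (Fin.castLE hr i) 0).take n) ⊔
      (order d r).initialIdeal (ideal K d) =
    Ideal.span ((fun s => monomial s (1 : K)) '' extendedExps d r n) := by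
  rw [initialIdeal_eq, Ideal.ofList, ← Ideal.span_union, extendedExps, Set.image_union]
  congr 2
  ext g
  simp only [Set.mem_ofPred_eq, List.mem_take_iff_getElem, List.length_ofFn, List.getElem_ofFn,
    Set.mem_image]
  constructor
  · rintro ⟨j, hj, rfl⟩
    exact ⟨_, ⟨⟨j, by omega⟩, by simp; omega, rfl⟩, rfl⟩
  · rintro ⟨_, ⟨j, hj, rfl⟩, rfl⟩
    exact ⟨j, by omega, rfl⟩

theorem isWeaklyRegular_initialIdeal {d r : ℕ} (hr : r ≤ d) :
    RingTheory.Sequence.IsWeaklyRegular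
      (MvPolynomial (Fin (3 * d)) K ⧸ (order d r).initialIdeal (ideal K d))
      (List.ofFn fun i : Fin r => x K (Fin.castLE hr i) 0) := by
  apply isWeaklyRegular_quotient_of_forall_mem
  intro n hn p hp
  have hn' : n < r := by simpa using hn
  rw [ofList_sup_initialIdeal K hr hn'.le] at hp ⊢
  rw [List.getElem_ofFn, x_eq_X] at hp
  refine mem_span_monomial_of_X_mul_mem ?_ hp
  rintro s (⟨j, hj, rfl⟩ | ⟨i, ρ, hρ, rfl⟩)
  · rw [Finsupp.single_apply, if_neg]
    rw [idx_inj]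
    rintro ⟨rfl, -⟩
    simp at hj
  · rw [blockExp_idx]
    split_ifs with hi
    · subst hi
      simp only [rules, Fin.val_castLE, hn', if_true, List.mem_cons, List.not_mem_nil,
        or_false] at hρ
      rcases hρ with rfl | rfl | rfl <;> rfl
    · rfl

/-- The exponent of the monomial `(∏ i < r, x i 1) * (∏ i ≥ r, x i 0)`. -/
noncomputable def socleExp (d r : ℕ) : Fin (3 * d) →₀ ℕ :=
  ∑ i : Fin d, Finsupp.single (idx i (if (i : ℕ) < r then 1 else 0)) 1

theorem socleExp_idx {d : ℕ} (r : ℕ) (i : Fin d) (j : Fin 3) :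
    socleExp d r (idx i j) = if j = (if (i : ℕ) < r then 1 else 0) then 1 else 0 := by
  simp only [socleExp, Finsupp.coe_finsetSum, Finset.sum_apply, Finsupp.single_apply, idx_inj]
  rw [Finset.sum_eq_single i (fun b _ hb => by simp [hb]) (by simp)]
  simp [eq_comm]

theorem not_le_socleExp {d r : ℕ} (s) (hs : s ∈ extendedExps d r r) : ¬ s ≤ socleExp d r := by
  rcases hs with ⟨j, hj, rfl⟩ | ⟨i, ρ, hρ, rfl⟩
  · intro h
    simpa [socleExp_idx, hj] using h (idx j 0)
  · rw [blockExp_le_iff]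
    intro h
    simp only [socleExp_idx] at h
    have h0 := h 0
    have h1 := h 1
    have h2 := h 2
    by_cases hi : (i : ℕ) < r
    · simp only [rules, hi, if_true, List.mem_cons, List.not_mem_nil, or_false] at hρ h0 h1 h2
      rcases hρ with rfl | rfl | rfl <;> simp at h0 h1 h2
    · simp only [rules, hi, if_false, List.mem_cons, List.not_mem_nil, or_false] at hρ h0 h1 h2
      rcases hρ with rfl | rfl | rfl | rfl <;> simp at h0 h1 h2

/-- Every variable kills the socle monomial modulo `in(I) + (x i 0 : i < r)`. -/
theorem exists_le_single_add_socleExp {d : ℕ} (r : ℕ) (k : Fin (3 * d)) :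
    ∃ s ∈ extendedExps d r r, s ≤ Finsupp.single k 1 + socleExp d r := by
  obtain ⟨i, j, rfl⟩ := idx_surjective k
  have aux : ∀ ρ ∈ rules ((i : ℕ) < r),
      (∀ j', ρ.1 j' ≤ (if j = j' then 1 else 0) +
        if j' = (if (i : ℕ) < r then 1 else 0) then 1 else 0) →
      ∃ s ∈ extendedExps d r r, s ≤ Finsupp.single (idx i j) 1 + socleExp d r := by
    intro ρ hρ h
    refine ⟨_, Or.inr ⟨i, ρ, hρ, rfl⟩, (blockExp_le_iff _ _ _).2 fun j' => ?_⟩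
    simpa [socleExp_idx, Finsupp.single_apply] using h j'
  by_cases hi : (i : ℕ) < r
  · simp only [rules, hi, if_true] at aux
    fin_cases j
    · exact ⟨_, Or.inl ⟨i, hi, rfl⟩, le_self_add⟩
    · exact aux (![0, 2, 0], ![1, 0, 1]) (by simp) (by decide)
    · exact aux (![0, 1, 1], ![2, 0, 0]) (by simp) (by decide)
  · simp only [rules, hi, if_false] at aux
    fin_cases j
    · exact aux (![2, 0, 0], ![0, 1, 1]) (by simp) (by decide)
    · exact aux (![1, 1, 0], ![0, 0, 2]) (by simp) (by decide)
    · exact aux (![1, 0, 1], ![0, 2, 0]) (by simp) (by decide)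

theorem one_notMem_idealOfVars_sup (d r : ℕ) :
    (1 : MvPolynomial (Fin (3 * d)) K) ∉
      idealOfVars (Fin (3 * d)) K ⊔ (order d r).initialIdeal (ideal K d) := by
  have h : idealOfVars (Fin (3 * d)) K ⊔ (order d r).initialIdeal (ideal K d) ≤
      RingHom.ker (constantCoeff : MvPolynomial (Fin (3 * d)) K →+* K) := by
    rw [initialIdeal_eq]
    refine sup_le (Ideal.span_le.2 ?_) (Ideal.span_le.2 ?_)
    · rintro _ ⟨k, rfl⟩
      simp [RingHom.mem_ker]
    · rintro _ ⟨s, hs, rfl⟩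
      rw [SetLike.mem_coe, RingHom.mem_ker, constantCoeff_monomial, if_neg]
      rintro rfl
      exact not_le_socleExp 0 (Or.inr hs) zero_le
  intro h1
  simpa [RingHom.mem_ker] using h h1

theorem depthQuotient_initialIdeal {d r : ℕ} (hr : r ≤ d) :
    depthQuotient ((order d r).initialIdeal (ideal K d)) = (r : ℕ∞) := by
  set H := (order d r).initialIdeal (ideal K d) with hH
  set rs := List.ofFn fun i : Fin r => x K (Fin.castLE hr i) 0 with hrs
  have hlen : rs.length = r := by simp [hrs]
  have hE : Ideal.ofList rs ⊔ H =
      Ideal.span ((fun s => monomial s (1 : K)) '' extendedExps d r r) := by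
    rw [← ofList_sup_initialIdeal K hr le_rfl, ← hrs, List.take_of_length_le hlen.le]
  have hJ : idealOfVars (Fin (3 * d)) K •
      (⊤ : Submodule (MvPolynomial (Fin (3 * d)) K) (MvPolynomial (Fin (3 * d)) K ⧸ H)) ≠ ⊤ := by
    intro h
    apply one_notMem_idealOfVars_sup K d r
    rw [← Ideal.mk_mem_smul_top_iff, h]
    trivial
  have hmem : ∀ a ∈ rs, a ∈ idealOfVars (Fin (3 * d)) K := by
    intro a ha
    obtain ⟨i, rfl⟩ := (List.mem_ofFn' _ _).1 ha
    exact Ideal.subset_span ⟨_, rfl⟩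
  have hreg := isWeaklyRegular_initialIdeal K hr
  have hm : Ideal.Quotient.mk H (monomial (socleExp d r) 1) ∉ Ideal.ofList rs •
      (⊤ : Submodule (MvPolynomial (Fin (3 * d)) K) (MvPolynomial (Fin (3 * d)) K ⧸ H)) := by
    rw [Ideal.mk_mem_smul_top_iff, hE, mem_ideal_span_monomial_image]
    intro h
    obtain ⟨s, hs, hle⟩ := h (socleExp d r) (by simp)
    exact not_le_socleExp s hs hle
  have hsocle : ∀ a ∈ idealOfVars (Fin (3 * d)) K,
      a • Ideal.Quotient.mk H (monomial (socleExp d r) 1) ∈ Ideal.ofList rs •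
      (⊤ : Submodule (MvPolynomial (Fin (3 * d)) K) (MvPolynomial (Fin (3 * d)) K ⧸ H)) := by
    intro a ha
    induction ha using Submodule.span_induction with
    | mem a ha =>
      obtain ⟨k, rfl⟩ := ha
      change Ideal.Quotient.mk H (X k * monomial (socleExp d r) 1) ∈ _
      rw [Ideal.mk_mem_smul_top_iff, hE, mem_ideal_span_monomial_image]
      intro u hu
      rw [X, monomial_mul, mul_one] at hu
      rw [Finset.mem_singleton.1 (support_monomial_subset hu)]
      exact exists_le_single_add_socleExp r k
    | zero => rw [zero_smul]; exact zero_mem _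
    | add a b _ _ ha hb => rw [add_smul]; exact add_mem ha hb
    | smul c a _ ha => rw [smul_assoc]; exact Submodule.smul_mem _ c ha
  rw [depthQuotient, Ideal.depthOn, if_neg hJ]
  refine le_antisymm (sSup_le ?_) (
    le_sSup ⟨rs, hmem, ⟨hreg, fun h => hm (h ▸ trivial)⟩, by rw [hlen]⟩)
  rintro _ ⟨rs', hrs', hreg', rfl⟩
  rw [← hlen]
  exact_mod_cast length_le_of_socle _ rs hmem _ hJ hreg _ hm hsocle rs' hrs' hreg'

theorem isHomogeneous_ideal (d : ℕ) :
    (ideal K d).IsHomogeneous (homogeneousSubmodule (Fin (3 * d)) K) := by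
  refine Ideal.homogeneous_span _ _ fun g hg => ⟨2, ?_⟩
  have h2 : ∀ (i : Fin d) (j j' : Fin 3), (x K i j * x K i j').IsHomogeneous 2 :=
    fun i j j' => (isHomogeneous_X K _).mul (isHomogeneous_X K _)
  simp only [Set.mem_iUnion, Set.mem_insert_iff, Set.mem_singleton_iff, pow_two] at hg
  rw [mem_homogeneousSubmodule]
  obtain ⟨i, rfl | rfl | rfl⟩ := hg <;> exact (h2 i _ _).sub (h2 i _ _)

end TripleIdeal

theorem theorem2p1 (K : Type*) [Field K] (d : ℕ) (hd : 0 < d) :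
    (TripleIdeal.ideal K d).IsHomogeneous (MvPolynomial.homogeneousSubmodule (Fin (3 * d)) K) ∧
    IsCohenMacaulayRing (MvPolynomial (Fin (3 * d)) K ⧸ TripleIdeal.ideal K d) ∧
    ringKrullDim (MvPolynomial (Fin (3 * d)) K ⧸ TripleIdeal.ideal K d) = (d : WithBot ℕ∞) ∧
    ∀ r : ℕ, r ≤ d →
      (TripleIdeal.order d r).IsGroebnerBasis
        (TripleIdeal.basisA K d r ∪ TripleIdeal.basisB K d r) (TripleIdeal.ideal K d) ∧
      MvPolynomial.depthQuotient
        ((TripleIdeal.order d r).initialIdeal (TripleIdeal.ideal K d)) = (r : ℕ∞) :=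
  ⟨TripleIdeal.isHomogeneous_ideal K d, TripleIdeal.isCohenMacaulayRing_quotient K d,
    le_antisymm (TripleIdeal.ringKrullDim_quotient_le K d)
      (TripleIdeal.le_ringKrullDim_quotient K d),
    fun r hr => ⟨TripleIdeal.isGroebnerBasis K d r, TripleIdeal.depthQuotient_initialIdeal K hr⟩⟩
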